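/- Let $q$ be a prime power and, for $0 \le k \le n$, let $L_{n,k}$ be the set of $k$-dimensional linear subspaces of $(\mathbb{F}_q)^n$. For $T \subseteq L_{n,k}$ let $\mu_k(T) = |T|/|L_{n,k}|$ be its density. For $1 \le k \le n$ and $S \subseteq L_{n,k}$, the shadow of $S$ is $$\partial S = \{B \in L_{n,k-1} : B \subset A \text{ for some } A \in S\}.$$ Theorem. For all integers $1 \le k \le n$ and every $S \subseteq L_{n,k}$, if $\mu_k(S) = (1+z)^{-1}$ where $z$ is a real number with $z \ge 0$, then $$\mu_{k-1}(\partial S) \;\ge\; \left(1 + \frac{q(q^{k-1}-1)(q^{n-k}-1)}{(q^k-1)(q^{n-k+1}-1)}\cdot z\right)^{-1} \;\ge\; \left(1+\frac{z}{q}\right)^{-1}.$$ -/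

import Mathlib

/-- The set `L_{n,k}` of all `k`-dimensional linear subspaces of `F ^ n`. -/
def subspacesOfDim (F : Type*) [Field F] (n k : ℕ) : Set (Submodule F (Fin n → F)) :=
  {A | Module.finrank F A = k}

/-- The density `μ_k(Q)`: the fraction of the `k`-dimensional subspaces of `F ^ n` that belong
to `Q` (meant for a finite field `F` and for `k ≤ n`). -/
noncomputable def subspaceDensity {F : Type*} [Field F] {n : ℕ} (k : ℕ)
    (Q : Set (Submodule F (Fin n → F))) : ℝ :=
  ((Q ∩ subspacesOfDim F n k).ncard : ℝ) / ((subspacesOfDim F n k).ncard : ℝ)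

/-- The shadow `∂S` of a set `S` of `k`-dimensional subspaces (for `1 ≤ k`): the set of all
`(k - 1)`-dimensional subspaces that are contained in some member of `S`. -/
def subspaceShadow {F : Type*} [Field F] {n : ℕ} (k : ℕ)
    (S : Set (Submodule F (Fin n → F))) : Set (Submodule F (Fin n → F)) :=
  {B | B ∈ subspacesOfDim F n (k - 1) ∧ ∃ A ∈ S, B ≤ A}

/-!
The proof is spectral. Give the `k`-dimensional subspaces of `V = F ^ n` the counting inner product,
and let `sumAbove` and `sumBelow` be the two mutually adjoint inclusion operators between
consecutive dimensions, with `[m] = (q ^ m - 1) / (q - 1)`.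

* A `(k + 1)`-dimensional space has `[k + 1]` hyperplanes and `[n - k - 1]` covers
  (`card_hyperplanes`, `card_covers`), and two distinct ones have equally many common hyperplanes
  and common covers (`card_common_covers`). Hence going up and back down differs from going down
  and back up by the scalar `[n - k - 1] - [k + 1]` (`sum_sq_sumBelow_eq`).
* By induction on the dimension, the map from functions on `(k + 1)`-dimensional subspaces to
  functions on `k`-dimensional ones has squared norm at most `q [k] [n - k - 1]` on functions of sum
  zero (`sum_sq_sumAbove_le`): the commutation relation adds the scalar, and passing from an operator
  to its adjoint preserves the norm.
* Applied to the centred indicator of `S`, this bounds the second moment of the number of members of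
  `S` above a random subspace. As that number vanishes off the shadow, Cauchy–Schwarz turns the
  second moment bound into a lower bound for the size of the shadow (`card_shadow_bound`).
-/

open Module Finset

section Grassmannian

variable {F V : Type*} [Field F] [AddCommGroup V] [Module F V] [Finite V]

/-! ### Grassmannians and q-integers -/

/-- The `q`-integer `[m]_q = (q ^ m - 1) / (q - 1)`, meant for `q ≠ 1`. -/
noncomputable def qInteger (q : ℝ) (m : ℕ) : ℝ := (q ^ m - 1) / (q - 1)

theorem qInteger_succ {q : ℝ} (hq : 1 < q) (m : ℕ) : qInteger q (m + 1) = q * qInteger q m + 1 := by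
  have : q - 1 ≠ 0 := by linarith
  unfold qInteger
  field_simp
  ring

theorem qInteger_nonneg {q : ℝ} (hq : 1 < q) (m : ℕ) : 0 ≤ qInteger q m :=
  div_nonneg (sub_nonneg.2 (one_le_pow₀ hq.le)) (by linarith)

theorem qInteger_zero (q : ℝ) : qInteger q 0 = 0 := by simp [qInteger]

theorem one_lt_natCard_real (F : Type*) [Field F] [Finite F] : (1 : ℝ) < Nat.card F := by
  exact_mod_cast Finite.one_lt_card

variable (F V) in
/-- The Grassmannian of `k`-dimensional subspaces of the finite space `V`, as a finset. -/
noncomputable def grassmannian (k : ℕ) : Finset (Submodule F V) :=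
  (Set.toFinite {A : Submodule F V | finrank F A = k}).toFinset

@[simp] theorem mem_grassmannian {k : ℕ} {A : Submodule F V} :
    A ∈ grassmannian F V k ↔ finrank F A = k := by simp [grassmannian]

open Classical in
/-- Two distinct `(k + 1)`-dimensional subspaces have as many common covers as common hyperplanes:
one of each if they meet in dimension `k` (the sum and the intersection), none otherwise. -/
theorem card_common_covers {k : ℕ} {A A' : Submodule F V} (hA : A ∈ grassmannian F V (k + 1))
    (hA' : A' ∈ grassmannian F V (k + 1)) (hne : A ≠ A') :
    #{C ∈ grassmannian F V (k + 2) | A ≤ C ∧ A' ≤ C}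
      = #{B ∈ grassmannian F V k | B ≤ A ∧ B ≤ A'} := by
  rw [mem_grassmannian] at hA hA'
  have hsum := Submodule.finrank_sup_add_finrank_inf_eq A A'
  have hinf : finrank F ↥(A ⊓ A') ≤ k := by
    by_contra! h
    have h1 : A ⊓ A' = A := Submodule.eq_of_le_of_finrank_le inf_le_left (by omega)
    have h2 : A ⊓ A' = A' := Submodule.eq_of_le_of_finrank_le inf_le_right (by omega)
    exact hne (h1.symm.trans h2)
  by_cases h : finrank F ↥(A ⊓ A') = k
  · have e1 : ({C ∈ grassmannian F V (k + 2) | A ≤ C ∧ A' ≤ C} : Finset _) = {A ⊔ A'} := by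
      ext C
      simp only [mem_filter, mem_grassmannian, mem_singleton]
      constructor
      · rintro ⟨hC, h1, h2⟩
        exact (Submodule.eq_of_le_of_finrank_le (sup_le h1 h2) (by omega)).symm
      · rintro rfl
        exact ⟨by omega, le_sup_left, le_sup_right⟩
    have e2 : ({B ∈ grassmannian F V k | B ≤ A ∧ B ≤ A'} : Finset _) = {A ⊓ A'} := by
      ext B
      simp only [mem_filter, mem_grassmannian, mem_singleton]
      constructor
      · rintro ⟨hB, h1, h2⟩
        exact Submodule.eq_of_le_of_finrank_le (le_inf h1 h2) (by omega)
      · rintro rfl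
        exact ⟨by omega, inf_le_left, inf_le_right⟩
    rw [e1, e2, card_singleton, card_singleton]
  · rw [filter_false_of_mem, filter_false_of_mem]
    · rintro B hB ⟨h1, h2⟩
      have := Submodule.finrank_mono (le_inf h1 h2)
      rw [mem_grassmannian] at hB
      omega
    · rintro C hC ⟨h1, h2⟩
      have := Submodule.finrank_mono (sup_le h1 h2)
      rw [mem_grassmannian] at hC
      omega

/-! ### The inclusion operators -/

open Classical in
/-- The inclusion operator towards lower dimension: `B` receives the sum of `f` over the
`k`-dimensional subspaces that contain `B`. -/
noncomputable def sumAbove (k : ℕ) (f : Submodule F V → ℝ) (B : Submodule F V) : ℝ :=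
  ∑ A ∈ grassmannian F V k with B ≤ A, f A

open Classical in
/-- The inclusion operator towards higher dimension: `A` receives the sum of `g` over the
`k`-dimensional subspaces contained in `A`. -/
noncomputable def sumBelow (k : ℕ) (g : Submodule F V → ℝ) (A : Submodule F V) : ℝ :=
  ∑ B ∈ grassmannian F V k with B ≤ A, g B

theorem sum_mul_sumAbove (j k : ℕ) (f g : Submodule F V → ℝ) :
    ∑ B ∈ grassmannian F V j, g B * sumAbove k f B
      = ∑ A ∈ grassmannian F V k, f A * sumBelow j g A := by
  classical
  simp only [sumAbove, sumBelow, mul_sum, sum_filter]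
  rw [sum_comm]
  refine sum_congr rfl fun A _ => sum_congr rfl fun B _ => ?_
  split_ifs <;> ring

/-! ### Covers and hyperplanes -/

open Classical in
/-- The vectors outside `B` are partitioned by the subspaces covering `B`: the class of `v` is
`B ⊔ span {v}`. -/
theorem card_covers_mul {k : ℕ} {B : Submodule F V} (hB : B ∈ grassmannian F V k) :
    (#{A ∈ grassmannian F V (k + 1) | B ≤ A} : ℝ) * ((Nat.card F : ℝ) ^ (k + 1) - Nat.card F ^ k)
      = (Nat.card F : ℝ) ^ finrank F V - Nat.card F ^ k := by
  have := Fintype.ofFinite V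
  have hcard (A : Submodule F V) (hBA : B ≤ A) : (#{v : V | v ∈ A ∧ v ∉ B} : ℝ)
      = (Nat.card F : ℝ) ^ finrank F A - Nat.card F ^ k := by
    have h1 (A : Submodule F V) : #{v : V | v ∈ A} = Nat.card F ^ finrank F A := by
      rw [← natCard_eq_pow_finrank, Nat.card_eq_fintype_card, Fintype.card_subtype]
    have h2 : #{v : V | v ∈ A ∧ v ∉ B} + #{v : V | v ∈ B} = #{v : V | v ∈ A} := by
      rw [← card_filter_add_card_filter_not (s := ({v : V | v ∈ A} : Finset V)) (· ∈ B), add_comm,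
        filter_filter, filter_filter]
      congr 2
      ext v
      simpa using fun h => hBA h
    rw [h1, h1, mem_grassmannian.1 hB] at h2
    exact eq_sub_of_add_eq (by exact_mod_cast h2)
  have hmaps : Set.MapsTo (fun v : V => B ⊔ Submodule.span F {v})
      (({v : V | v ∉ B} : Finset V) : Set V)
      (({A ∈ grassmannian F V (k + 1) | B ≤ A} : Finset (Submodule F V)) : Set _) := by
    intro v hv
    simp only [coe_filter, mem_univ, true_and, Set.mem_ofPred_eq, mem_grassmannian] at hv ⊢
    exact ⟨by rw [Submodule.finrank_sup_span_singleton hv, mem_grassmannian.1 hB], le_sup_left⟩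
  have hfib : ∀ A ∈ ({A ∈ grassmannian F V (k + 1) | B ≤ A} : Finset (Submodule F V)),
      (#{v ∈ ({v : V | v ∉ B} : Finset V) | B ⊔ Submodule.span F {v} = A} : ℝ)
        = (Nat.card F : ℝ) ^ (k + 1) - Nat.card F ^ k := by
    intro A hA
    obtain ⟨hA, hBA⟩ := mem_filter.1 hA
    rw [mem_grassmannian] at hA
    rw [← hA, ← hcard A hBA, filter_filter]
    congr 2
    ext v
    simp only [mem_filter, mem_univ, true_and]
    constructor
    · rintro ⟨hv, rfl⟩
      exact ⟨Submodule.mem_sup_right (Submodule.mem_span_singleton_self v), hv⟩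
    · rintro ⟨hvA, hv⟩
      refine ⟨hv, Submodule.eq_of_le_of_finrank_le (sup_le hBA ?_) ?_⟩
      · simpa using hvA
      · rw [hA, Submodule.finrank_sup_span_singleton hv, mem_grassmannian.1 hB]
  have htop := hcard ⊤ le_top
  simp only [Submodule.mem_top, true_and, finrank_top] at htop
  rw [← htop, card_eq_sum_card_fiberwise hmaps, Nat.cast_sum, sum_congr rfl hfib, sum_const,
    nsmul_eq_mul]

variable [Finite F]

open Classical in
theorem card_covers {k : ℕ} {B : Submodule F V} (hB : B ∈ grassmannian F V k) :
    (#{A ∈ grassmannian F V (k + 1) | B ≤ A} : ℝ)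
      = qInteger (Nat.card F) (finrank F V - k) := by
  have hq := one_lt_natCard_real F
  have hk : k ≤ finrank F V := mem_grassmannian.1 hB ▸ Submodule.finrank_le B
  have h := card_covers_mul hB
  have hpos : (0 : ℝ) < (Nat.card F : ℝ) ^ k := by positivity
  obtain ⟨m, hm⟩ := Nat.exists_eq_add_of_le hk
  rw [hm] at h ⊢
  rw [Nat.add_sub_cancel_left, qInteger, eq_div_iff (by linarith)]
  apply mul_left_cancel₀ hpos.ne'
  rw [pow_add, pow_succ] at h
  linear_combination h

open Classical in
/-- Annihilators in the dual of `A` turn the hyperplanes of `A` into lines, that is, into the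
covers of `⊥`. -/
theorem card_hyperplanes {k : ℕ} {A : Submodule F V} (hA : A ∈ grassmannian F V (k + 1)) :
    (#{B ∈ grassmannian F V k | B ≤ A} : ℝ) = qInteger (Nat.card F) (k + 1) := by
  rw [mem_grassmannian] at hA
  have : Finite (Dual F A) := Module.finite_of_finite F
  have hdual := card_covers (F := F) (V := Dual F A) (k := 0) (B := ⊥) (by simp)
  rw [Subspace.dual_finrank_eq, hA, Nat.sub_zero] at hdual
  rw [← hdual, Nat.cast_inj]
  refine (card_nbij' (fun W : Submodule F (Dual F A) => W.dualCoannihilator.map A.subtype)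
    (fun B => (B.comap A.subtype).dualAnnihilator) ?_ ?_ ?_ ?_).symm
  · intro W hW
    simp only [coe_filter, mem_grassmannian, Set.mem_ofPred_eq, bot_le, and_true] at hW ⊢
    refine ⟨?_, Submodule.map_subtype_le _ _⟩
    rw [Submodule.finrank_map_subtype_eq]
    have := Subspace.finrank_add_finrank_dualCoannihilator_eq W
    omega
  · intro B hB
    simp only [coe_filter, mem_grassmannian, Set.mem_ofPred_eq, bot_le, and_true] at hB ⊢
    have h1 := Subspace.finrank_add_finrank_dualAnnihilator_eq (B.comap A.subtype)
    have h2 := (Submodule.comapSubtypeEquivOfLe hB.2).finrank_eq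
    omega
  · intro W _
    simp only
    rw [Submodule.comap_map_eq_of_injective A.injective_subtype,
      Subspace.dualCoannihilator_dualAnnihilator_eq]
  · intro B hB
    simp only [coe_filter, mem_grassmannian, Set.mem_ofPred_eq] at hB
    simp only
    rw [Subspace.dualAnnihilator_dualCoannihilator_eq, Submodule.map_comap_subtype,
      inf_eq_right.2 hB.2]

theorem sumBelow_one {k : ℕ} {A : Submodule F V} (hA : A ∈ grassmannian F V (k + 1)) :
    sumBelow k (fun _ => 1) A = qInteger (Nat.card F) (k + 1) := by
  simp [sumBelow, ← card_hyperplanes hA]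

theorem sumAbove_one {k : ℕ} {B : Submodule F V} (hB : B ∈ grassmannian F V k) :
    sumAbove (k + 1) (fun _ => 1) B = qInteger (Nat.card F) (finrank F V - k) := by
  simp [sumAbove, ← card_covers hB]

theorem sum_sumAbove (k : ℕ) (f : Submodule F V → ℝ) :
    ∑ B ∈ grassmannian F V k, sumAbove (k + 1) f B
      = qInteger (Nat.card F) (k + 1) * ∑ A ∈ grassmannian F V (k + 1), f A := by
  have h := sum_mul_sumAbove k (k + 1) f (fun _ => 1)
  simp only [one_mul] at h
  rw [h, mul_sum]
  refine sum_congr rfl fun A hA => ?_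
  rw [sumBelow_one hA, mul_comm]

theorem sum_sq_sum_filter {α β : Type*} (s : Finset α) (t : Finset β) (r : α → β → Prop)
    [∀ b a, Decidable (r b a)] (f : β → ℝ) :
    ∑ b ∈ s, (∑ a ∈ t with r b a, f a) ^ 2
      = ∑ a ∈ t, ∑ a' ∈ t, f a * f a' * #{b ∈ s | r b a ∧ r b a'} := by
  simp only [sum_filter, sq, sum_mul_sum]
  simp only [card_filter, Nat.cast_sum, mul_sum]
  rw [sum_comm]
  refine sum_congr rfl fun a _ => ?_
  rw [sum_comm]
  refine sum_congr rfl fun a' _ => sum_congr rfl fun b _ => ?_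
  rw [ite_zero_mul_ite_zero]
  split_ifs <;> simp

/-- The commutation relation between the inclusion operators, as an identity of quadratic forms.
Off the diagonal the forms agree by `card_common_covers`. -/
theorem sum_sq_sumBelow_eq (k : ℕ) (f : Submodule F V → ℝ) :
    ∑ C ∈ grassmannian F V (k + 2), sumBelow (k + 1) f C ^ 2
      = ∑ B ∈ grassmannian F V k, sumAbove (k + 1) f B ^ 2
        + (qInteger (Nat.card F) (finrank F V - (k + 1)) - qInteger (Nat.card F) (k + 1))
          * ∑ A ∈ grassmannian F V (k + 1), f A ^ 2 := by
  classical
  simp only [sumBelow, sumAbove]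
  rw [sum_sq_sum_filter, sum_sq_sum_filter _ _ (fun B A : Submodule F V => B ≤ A), mul_sum, ← sum_add_distrib]
  refine sum_congr rfl fun A hA => ?_
  rw [← add_sum_erase _ _ hA, ← add_sum_erase _ _ hA]
  have hoff : ∀ A' ∈ (grassmannian F V (k + 1)).erase A,
      f A * f A' * (#{C ∈ grassmannian F V (k + 2) | A ≤ C ∧ A' ≤ C} : ℝ)
        = f A * f A' * (#{B ∈ grassmannian F V k | B ≤ A ∧ B ≤ A'} : ℝ) := by
    intro A' hA'
    obtain ⟨hne, hA'⟩ := mem_erase.1 hA'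
    rw [card_common_covers hA hA' hne.symm]
  rw [sum_congr rfl hoff]
  simp only [and_self]
  rw [card_covers hA, card_hyperplanes hA]
  ring

/-! ### The spectral gap -/

/-- On functions of sum zero, `sumAbove` has squared operator norm at most `q [k] [n - k - 1]`. -/
theorem sum_sq_sumAbove_le (k : ℕ) (hk : k + 1 ≤ finrank F V) (f : Submodule F V → ℝ)
    (hf : ∑ A ∈ grassmannian F V (k + 1), f A = 0) :
    ∑ B ∈ grassmannian F V k, sumAbove (k + 1) f B ^ 2
      ≤ Nat.card F * qInteger (Nat.card F) k * qInteger (Nat.card F) (finrank F V - (k + 1))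
        * ∑ A ∈ grassmannian F V (k + 1), f A ^ 2 := by
  have hq := one_lt_natCard_real F
  induction k generalizing f with
  | zero =>
    rw [qInteger_zero, mul_zero, zero_mul, zero_mul]
    refine (sum_eq_zero fun B hB => ?_).le
    have hB : B = ⊥ := by simpa using hB
    simp [sumAbove, hB, hf]
  | succ k ih =>
    set q := (Nat.card F : ℝ)
    set g := sumAbove (k + 2) f with hg
    have hg0 : ∑ B ∈ grassmannian F V (k + 1), g B = 0 := by
      rw [hg, sum_sumAbove, hf, mul_zero]
    obtain ⟨m, hm⟩ := Nat.exists_eq_add_of_le hk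
    have e1 : finrank F V - (k + 1) = m + 1 := by omega
    have e2 : finrank F V - (k + 1 + 1) = m := by omega
    -- The commutation relation moves the bound one dimension up.
    have hup := sum_sq_sumBelow_eq k g
    have hlow := ih (by omega) g hg0
    rw [e1, qInteger_succ hq m] at hup hlow
    rw [e2]
    have hbelow : ∑ A ∈ grassmannian F V (k + 2), sumBelow (k + 1) g A ^ 2
        ≤ q * qInteger q (k + 1) * qInteger q m * ∑ B ∈ grassmannian F V (k + 1), g B ^ 2 := by
      rw [qInteger_succ hq k] at hup ⊢
      linarith
    -- Cauchy–Schwarz transfers it from an operator to its adjoint.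
    have hcs := sum_mul_sq_le_sq_mul_sq (grassmannian F V (k + 2)) f (sumBelow (k + 1) g)
    rw [← sum_mul_sumAbove, ← hg] at hcs
    simp only [← sq] at hcs
    set X := ∑ B ∈ grassmannian F V (k + 1), g B ^ 2
    set Y := ∑ A ∈ grassmannian F V (k + 2), f A ^ 2
    have hX : 0 ≤ X := sum_nonneg fun _ _ => sq_nonneg _
    have hY : 0 ≤ Y := sum_nonneg fun _ _ => sq_nonneg _
    have hθ : 0 ≤ q * qInteger q (k + 1) * qInteger q m :=
      mul_nonneg (mul_nonneg (by linarith) (qInteger_nonneg hq _)) (qInteger_nonneg hq _)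
    rcases hX.eq_or_lt with h0 | hpos
    · rw [← h0]; exact mul_nonneg hθ hY
    · refine le_of_mul_le_mul_right ?_ hpos
      calc X * X = X ^ 2 := (sq X).symm
        _ ≤ Y * (q * qInteger q (k + 1) * qInteger q m * X) :=
          hcs.trans (mul_le_mul_of_nonneg_left hbelow hY)
        _ = _ := by ring

/-! ### Shadows -/

theorem card_grassmannian_mul (k : ℕ) :
    (#(grassmannian F V k) : ℝ) * qInteger (Nat.card F) (finrank F V - k)
      = #(grassmannian F V (k + 1)) * qInteger (Nat.card F) (k + 1) := by
  have h := sum_sumAbove (F := F) (V := V) k (fun _ => 1)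
  rw [sum_congr rfl fun B hB => sumAbove_one hB] at h
  simpa [mul_comm] using h

open Classical in
/-- Writing `a B` for the number of members of `S` above `B`, the spectral gap applied to the
centred indicator of `S` bounds `∑ a ^ 2` from above, while `∑ a = [k + 1] * #S` and
Cauchy–Schwarz on the shadow bound it from below. -/
theorem card_shadow_bound (k : ℕ) (hk : k + 1 ≤ finrank F V) (S : Finset (Submodule F V))
    (hS : S ⊆ grassmannian F V (k + 1)) (hne : S.Nonempty) :
    (#(grassmannian F V (k + 1)) : ℝ) * #S * qInteger (Nat.card F) (k + 1) ^ 2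
      ≤ #{B ∈ grassmannian F V k | ∃ A ∈ S, B ≤ A}
        * (#S * qInteger (Nat.card F) (finrank F V - k) * qInteger (Nat.card F) (k + 1)
          + Nat.card F * qInteger (Nat.card F) k * qInteger (Nat.card F) (finrank F V - (k + 1))
            * (#(grassmannian F V (k + 1)) - #S)) := by
  set θ := (Nat.card F : ℝ) * qInteger (Nat.card F) k
    * qInteger (Nat.card F) (finrank F V - (k + 1)) with hθ
  have hM := card_grassmannian_mul (F := F) (V := V) k
  set N : ℝ := (#(grassmannian F V (k + 1)) : ℝ) with hN
  set s : ℝ := (#S : ℝ) with hs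
  set K := qInteger (Nat.card F) (k + 1)
  set r := qInteger (Nat.card F) (finrank F V - k) with hr
  have hspos : 0 < s := Nat.cast_pos.2 hne.card_pos
  have hNpos : 0 < N := hspos.trans_le (Nat.cast_le.2 (card_le_card hS))
  set χ : Submodule F V → ℝ := fun A => if A ∈ S then 1 else 0 with hχ
  have hχsum : ∑ A ∈ grassmannian F V (k + 1), χ A = s := by
    simp [hχ, sum_ite_mem, inter_eq_right.2 hS, hs]
  set a := sumAbove (k + 1) χ with ha
  have hasum : ∑ B ∈ grassmannian F V k, a B = K * s := by rw [ha, sum_sumAbove, hχsum]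
  -- The indicator is centred and scaled by `N` to avoid denominators.
  have hzero : ∑ A ∈ grassmannian F V (k + 1), (N * χ A - s) = 0 := by
    rw [sum_sub_distrib, ← mul_sum, hχsum, sum_const, nsmul_eq_mul, sub_self]
  have hnorm : ∑ A ∈ grassmannian F V (k + 1), (N * χ A - s) ^ 2 = N * s * (N - s) := by
    have : ∀ A, (N * χ A - s) ^ 2 = (N ^ 2 - 2 * N * s) * χ A + s ^ 2 := by
      intro A
      by_cases h : A ∈ S <;> simp only [hχ, h, if_true, if_false] <;> ring
    simp only [this]
    rw [sum_add_distrib, ← mul_sum, hχsum, sum_const, nsmul_eq_mul, ← hN]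
    ring
  have habove : ∀ B ∈ grassmannian F V k,
      sumAbove (k + 1) (fun A => N * χ A - s) B = N * a B - s * r := by
    intro B hB
    rw [hr, ← sumAbove_one hB]
    simp only [ha, sumAbove, mul_sum, sum_sub_distrib, mul_one]
  have hgap := sum_sq_sumAbove_le k hk _ hzero
  rw [hnorm, sum_congr rfl fun B hB => by rw [habove B hB], ← hθ] at hgap
  have hexpand : ∑ B ∈ grassmannian F V k, (N * a B - s * r) ^ 2
      = N * (N * ∑ B ∈ grassmannian F V k, a B ^ 2 - s ^ 2 * r * K) := by
    have : ∀ B, (N * a B - s * r) ^ 2 = N ^ 2 * a B ^ 2 - 2 * N * s * r * a B + s ^ 2 * r ^ 2 := by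
      intro B; ring
    simp only [this]
    rw [sum_add_distrib, sum_sub_distrib, ← mul_sum, ← mul_sum, hasum, sum_const, nsmul_eq_mul]
    linear_combination s ^ 2 * r * hM
  have hupper : N * ∑ B ∈ grassmannian F V k, a B ^ 2 ≤ s * (s * r * K + θ * (N - s)) := by
    refine le_of_mul_le_mul_left ?_ hNpos
    rw [hexpand] at hgap
    linarith
  set T : Finset (Submodule F V) := {B ∈ grassmannian F V k | ∃ A ∈ S, B ≤ A} with hT
  have hsupp : ∀ B ∈ grassmannian F V k, B ∉ T → a B = 0 := by
    intro B hB hBT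
    refine sum_eq_zero fun A hA => if_neg fun hAS => hBT ?_
    exact mem_filter.2 ⟨hB, A, hAS, (mem_filter.1 hA).2⟩
  have hlower : (K * s) ^ 2 ≤ #T * ∑ B ∈ grassmannian F V k, a B ^ 2 := by
    rw [← hasum, ← sum_subset (filter_subset _ _) hsupp]
    refine sq_sum_le_card_mul_sum_sq.trans ?_
    gcongr
    exact filter_subset _ _
  refine le_of_mul_le_mul_left ?_ hspos
  calc s * (N * s * K ^ 2) = N * (K * s) ^ 2 := by ring
    _ ≤ N * (#T * ∑ B ∈ grassmannian F V k, a B ^ 2) := by gcongr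
    _ = #T * (N * ∑ B ∈ grassmannian F V k, a B ^ 2) := by ring
    _ ≤ #T * (s * (s * r * K + θ * (N - s))) := by gcongr
    _ = _ := by ring

end Grassmannian

theorem subspacesOfDim_eq_coe_grassmannian {F : Type*} [Field F] [Finite F] (n k : ℕ) :
    subspacesOfDim F n k = (grassmannian F (Fin n → F) k : Set (Submodule F (Fin n → F))) := by
  ext A
  simp [subspacesOfDim]

theorem theorem1 {F : Type*} [Field F] [Fintype F] (q : ℕ) (hq : Fintype.card F = q)
    (n k : ℕ) (hk : 1 ≤ k) (hkn : k ≤ n)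
    (S : Set (Submodule F (Fin n → F))) (hS : S ⊆ subspacesOfDim F n k)
    (z : ℝ) (hz : 0 ≤ z) (hμ : subspaceDensity k S = (1 + z)⁻¹) :
    (1 + ((q : ℝ) * ((q : ℝ) ^ (k - 1) - 1) * ((q : ℝ) ^ (n - k) - 1)) /
          (((q : ℝ) ^ k - 1) * ((q : ℝ) ^ (n - k + 1) - 1)) * z)⁻¹
        ≤ subspaceDensity (k - 1) (subspaceShadow k S) ∧
      (1 + z / (q : ℝ))⁻¹ ≤
        (1 + ((q : ℝ) * ((q : ℝ) ^ (k - 1) - 1) * ((q : ℝ) ^ (n - k) - 1)) /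
          (((q : ℝ) ^ k - 1) * ((q : ℝ) ^ (n - k + 1) - 1)) * z)⁻¹ := by
  classical
  obtain ⟨k, rfl⟩ := Nat.exists_eq_add_of_le' hk
  obtain ⟨m, rfl⟩ := Nat.exists_eq_add_of_le hkn
  have hq1 := one_lt_natCard_real F
  rw [Nat.card_eq_fintype_card, hq] at hq1
  have e1 : k + 1 + m - (k + 1) = m := by omega
  have e2 : k + 1 + m - k = m + 1 := by omega
  rw [e1, Nat.add_sub_cancel]
  set Q : ℝ := (q : ℝ)
  have hQ0 : 0 < Q - 1 := by linarith
  have hk0 : 0 ≤ Q ^ k - 1 := sub_nonneg.2 (one_le_pow₀ hq1.le)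
  have hm0 : 0 ≤ Q ^ m - 1 := sub_nonneg.2 (one_le_pow₀ hq1.le)
  have hk1 : 0 < Q ^ (k + 1) - 1 := sub_pos.2 (one_lt_pow₀ hq1 k.succ_ne_zero)
  have hm1 : 0 < Q ^ (m + 1) - 1 := sub_pos.2 (one_lt_pow₀ hq1 m.succ_ne_zero)
  set c := Q * (Q ^ k - 1) * (Q ^ m - 1) / ((Q ^ (k + 1) - 1) * (Q ^ (m + 1) - 1)) with hc
  have hc0 : 0 ≤ c := by positivity
  have hcz : 0 < 1 + c * z := by positivity
  refine ⟨?_, ?_⟩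
  · obtain ⟨S, rfl⟩ : ∃ S' : Finset (Submodule F (Fin (k + 1 + m) → F)), S = S' :=
      ⟨S.toFinite.toFinset, by simp⟩
    have hdensity : subspaceDensity (k + 1) (S : Set (Submodule F (Fin (k + 1 + m) → F)))
        = (#S : ℝ) / #(grassmannian F (Fin (k + 1 + m) → F) (k + 1)) := by
      rw [subspaceDensity, Set.inter_eq_left.2 hS, subspacesOfDim_eq_coe_grassmannian,
        Set.ncard_coe_finset, Set.ncard_coe_finset]
    have hshadow : subspaceShadow (k + 1) (S : Set (Submodule F (Fin (k + 1 + m) → F)))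
        = ({B ∈ grassmannian F (Fin (k + 1 + m) → F) k | ∃ A ∈ S, B ≤ A} : Finset _) := by
      ext B
      simp [subspaceShadow, subspacesOfDim]
    have hdensity' : subspaceDensity k
        (subspaceShadow (k + 1) (S : Set (Submodule F (Fin (k + 1 + m) → F))))
        = (#{B ∈ grassmannian F (Fin (k + 1 + m) → F) k | ∃ A ∈ S, B ≤ A} : ℝ)
          / #(grassmannian F (Fin (k + 1 + m) → F) k) := by
      rw [subspaceDensity, hshadow, subspacesOfDim_eq_coe_grassmannian, ← coe_inter,
        inter_eq_left.2 (filter_subset _ _), Set.ncard_coe_finset, Set.ncard_coe_finset]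
    rw [subspacesOfDim_eq_coe_grassmannian, coe_subset] at hS
    rw [hdensity] at hμ
    have hSne : S.Nonempty := by
      by_contra! h
      rw [h, card_empty, Nat.cast_zero, zero_div] at hμ
      exact (inv_pos.2 (by linarith : 0 < 1 + z)).ne hμ
    have hbound := card_shadow_bound k (by simp) S hS hSne
    have hcount := card_grassmannian_mul (F := F) (V := Fin (k + 1 + m) → F) k
    rw [Nat.card_eq_fintype_card, hq, finrank_fin_fun, e2] at hbound hcount
    rw [e1] at hbound
    rw [hdensity']
    have hspos : (0 : ℝ) < #S := by exact_mod_cast hSne.card_pos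
    have hNpos : (0 : ℝ) < #(grassmannian F (Fin (k + 1 + m) → F) (k + 1)) :=
      hspos.trans_le (Nat.cast_le.2 (card_le_card hS))
    set s : ℝ := (#S : ℝ)
    set N : ℝ := (#(grassmannian F (Fin (k + 1 + m) → F) (k + 1)) : ℝ)
    set M : ℝ := (#(grassmannian F (Fin (k + 1 + m) → F) k) : ℝ)
    set T : ℝ := (#{B ∈ grassmannian F (Fin (k + 1 + m) → F) k | ∃ A ∈ S, B ≤ A} : ℝ)
    have hK : 0 < qInteger Q (k + 1) := div_pos hk1 hQ0
    have hr : 0 < qInteger Q (m + 1) := div_pos hm1 hQ0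
    have hcmul : c * (qInteger Q (m + 1) * qInteger Q (k + 1))
        = Q * qInteger Q k * qInteger Q m := by
      simp only [hc, qInteger]
      field_simp
    have hMpos : 0 < M := pos_of_mul_pos_left (hcount ▸ mul_pos hNpos hK) hr.le
    have hN : N = s * (1 + z) := by
      have h1z : (1 + z) ≠ 0 := by positivity
      field_simp at hμ
      linarith
    have hMT : M ≤ T * (1 + c * z) := by
      refine le_of_mul_le_mul_right ?_ (mul_pos (mul_pos hspos hK) hr)
      calc M * (s * qInteger Q (k + 1) * qInteger Q (m + 1))
          = N * s * qInteger Q (k + 1) ^ 2 := by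
            linear_combination s * qInteger Q (k + 1) * hcount
        _ ≤ _ := hbound
        _ = T * (1 + c * z) * (s * qInteger Q (k + 1) * qInteger Q (m + 1)) := by
            rw [← hcmul, hN]
            ring
    rw [le_div_iff₀ hMpos, inv_mul_le_iff₀ hcz]
    linarith
  · have hcQ : c ≤ 1 / Q := by
      rw [hc, div_le_div_iff₀ (by positivity) (by positivity)]
      have h1 : Q * (Q ^ k - 1) ≤ Q ^ (k + 1) - 1 := by rw [pow_succ]; linarith
      have h2 : Q * (Q ^ m - 1) ≤ Q ^ (m + 1) - 1 := by rw [pow_succ]; linarith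
      calc Q * (Q ^ k - 1) * (Q ^ m - 1) * Q = (Q * (Q ^ k - 1)) * (Q * (Q ^ m - 1)) := by ring
        _ ≤ (Q ^ (k + 1) - 1) * (Q ^ (m + 1) - 1) := by gcongr
        _ = _ := (one_mul _).symm
    apply inv_anti₀ hcz
    have := mul_le_mul_of_nonneg_right hcQ hz
    rw [one_div_mul_eq_div] at this
    linarith
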